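/- Let $\mathcal P_2(\mathbb R^d)$ be the set of Borel probability measures on $\mathbb R^d$ with finite second moment, $\Pi(\mu,\nu)$ the set of couplings of $\mu,\nu$, and $W_2^2(\mu,\nu)=\inf_{\gamma\in\Pi(\mu,\nu)}\int\|x-y\|^2\,d\gamma(x,y)$. In a space $X$ with distance $D$, a curve $(c_t)_{t\ge 0}$ is a geodesic ray if $D(c_s,c_t)=|t-s|\,D(c_0,c_1)$ for all $s,t\ge0$; its speed is $D(c_0,c_1)$ and its Busemann function is $B^c(x)=\lim_{t\to\infty}\big(D(c_t,x)-t\,D(c_0,c_1)\big)$. Let $x_0\in\mathbb R^d$, $\mu_0=\delta_{x_0}$ and $\mu_1\in\mathcal P_2(\mathbb R^d)$ with $\mu_1\neq\delta_{x_0}$. Then there is a geodesic ray in $(\mathcal P_2(\mathbb R^d),W_2)$ from $\mu_0$ through $\mu_1$ (at time $1$), namely $\mu_t=\big((1-t)x_0+t\,\mathrm{Id}\big)_\#\mu_1$. Moreover, for every geodesic ray $(\mu_t)_{t\ge0}$ in $(\mathcal P_2(\mathbb R^d),W_2)$ that starts at $\mu_0=\delta_{x_0}$ and passes through $\mu_1$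 at time $1$, its speed $\kappa_\mu=W_2(\mu_0,\mu_1)$ is positive, and for every $\nu\in\mathcal P_2(\mathbb R^d)$: 1. The limit defining $B^\mu(\nu)$ exists, the integrals below converge, and $$B^\mu(\nu)=\inf_{\gamma\in\Pi(\mu_1,\nu)}\ -\kappa_\mu^{-1}\int\langle x_1-x_0,\,y-x_0\rangle\,d\gamma(x_1,y).$$ 2. This problem is equivalent to the optimal transport problem between $\mu_1$ and $\nu$ with cost $\|x-y\|^2$: for every $\gamma\in\Pi(\mu_1,\nu)$, $$-\kappa_\mu^{-1}\int\langle x_1-x_0,y-x_0\rangle\,d\gamma(x_1,y)=\frac{1}{2\kappa_\mu}\Big(\int\|x_1-y\|^2\,d\gamma(x_1,y)-\kappa_\mu^2-\int\|y-x_0\|^2\,d\nu(y)\Big);$$ consequently $B^\mu(\nu)=\frac{1}{2\kappa_\mu}\big(W_2^2(\mu_1,\nu)-\kappa_\mu^2-\int\|y-x_0\|^2\,d\nu(y)\big)$, and the minimizers of the problem in 1 are exactly the optimal couplings of $\mu_1$ and $\nu$. 3. If $\mu_1=\delta_{x_1}$ is a Dirac mass (so $x_1\ne x_0$), then $c(t)=x_0+t(x_1-x_0)$,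 $t\ge 0$, is a geodesic ray in $\mathbb R^d$, the limit defining its Euclidean Busemann function $B^c(y)$ exists for every $y\in\mathbb R^d$, $B^c$ is $\nu$-integrable, and $B^\mu(\nu)=\int B^c(y)\,d\nu(y)$. -/

import Mathlib

open MeasureTheory Filter Topology
open scoped NNReal

namespace WassersteinBusemann

/-- A curve `c : [0, ∞) → X` is a (constant speed) geodesic ray for the distance function `D`:
`D (c s) (c t) = |t - s| * D (c 0) (c 1)` for all `s, t ≥ 0`. -/
def IsGeodesicRay {X : Type*} (D : X → X → ℝ) (c : ℝ≥0 → X) : Prop :=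
  ∀ s t : ℝ≥0, D (c s) (c t) = |(t : ℝ) - (s : ℝ)| * D (c 0) (c 1)

/-- The speed of a ray: the distance between its positions at times `0` and `1`. -/
def speed {X : Type*} (D : X → X → ℝ) (c : ℝ≥0 → X) : ℝ :=
  D (c 0) (c 1)

/-- The quantity `D (c t) x - t * D (c 0) (c 1)` whose limit is the Busemann function. -/
def busemannApprox {X : Type*} (D : X → X → ℝ) (c : ℝ≥0 → X) (x : X) (t : ℝ≥0) : ℝ :=
  D (c t) x - speed D c * (t : ℝ)

/-- The Busemann function of the ray `c` for the distance function `D`,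
`x ↦ lim_{t → ∞} D (c t) x - t * D (c 0) (c 1)`. -/
noncomputable def busemann {X : Type*} (D : X → X → ℝ) (c : ℝ≥0 → X) (x : X) : ℝ :=
  limUnder atTop (busemannApprox D c x)

/-- `P₂(ℝᵈ)`: the Borel probability measures on `ℝᵈ` with finite second moment. -/
def P2 (d : ℕ) : Type :=
  {μ : Measure (EuclideanSpace ℝ (Fin d)) //
    IsProbabilityMeasure μ ∧ Integrable (fun x => ‖x‖ ^ 2) μ}

/-- The underlying measure of an element of `P₂(ℝᵈ)`. -/
def P2.measure {d : ℕ} (μ : P2 d) : Measure (EuclideanSpace ℝ (Fin d)) := μ.1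

/-- The Dirac mass at `x`, as an element of `P₂(ℝᵈ)`. -/
noncomputable def P2.dirac {d : ℕ} (x : EuclideanSpace ℝ (Fin d)) : P2 d :=
  ⟨Measure.dirac x, inferInstance, integrable_dirac (by simp)⟩

/-- `Π(μ, ν)`: the couplings of `μ` and `ν`. -/
def couplings {d : ℕ} (μ ν : P2 d) :
    Set (Measure (EuclideanSpace ℝ (Fin d) × EuclideanSpace ℝ (Fin d))) :=
  {γ | IsProbabilityMeasure γ ∧ γ.map Prod.fst = μ.measure ∧ γ.map Prod.snd = ν.measure}

/-- The quadratic transport cost `∫ ‖x - y‖² dγ(x, y)`. -/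
noncomputable def transportCost {d : ℕ}
    (γ : Measure (EuclideanSpace ℝ (Fin d) × EuclideanSpace ℝ (Fin d))) : ℝ :=
  ∫ p, ‖p.1 - p.2‖ ^ 2 ∂γ

/-- The 2-Wasserstein distance. The set of costs is non-empty (it contains the cost of the
product coupling), bounded below by `0`, and all its integrals converge. -/
noncomputable def W2 {d : ℕ} (μ ν : P2 d) : ℝ :=
  Real.sqrt (sInf (transportCost '' couplings μ ν))

/-- `Π_o(μ, ν)`: the optimal couplings, which attain the infimum defining `W₂(μ, ν)²`. -/
def optimalCouplings {d : ℕ} (μ ν : P2 d) :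
    Set (Measure (EuclideanSpace ℝ (Fin d) × EuclideanSpace ℝ (Fin d))) :=
  {γ | γ ∈ couplings μ ν ∧ IsMinOn transportCost (couplings μ ν) γ}

/-- The objective `γ ↦ -κ⁻¹ ∫ ⟨x₁ - x₀, y - x₀⟩ dγ(x₁, y)`. -/
noncomputable def innerCost {d : ℕ} (κ : ℝ) (x₀ : EuclideanSpace ℝ (Fin d))
    (γ : Measure (EuclideanSpace ℝ (Fin d) × EuclideanSpace ℝ (Fin d))) : ℝ :=
  -κ⁻¹ * ∫ p, inner ℝ (p.1 - x₀) (p.2 - x₀) ∂γ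

end WassersteinBusemann

/-! Expand `‖x - y‖²` about `x₀`: a coupling's cost is the sum of the two second moments minus twice
its correlation `∫ ⟨x - x₀, y - x₀⟩`. The moments see only the marginals, so minimizing the cost
means maximizing the correlation (`integral_inner_sub`). A homothety of ratio `t ≥ 0` applied to the
first marginal multiplies correlations by `t`, hence `W2 (μ.dilate x₀ t) ν ^ 2` is an explicit
quadratic in `t` (`W2_dilate_sq`).

This identity yields everything. With `ν` a dilate of `μ`, it shows that dilations form a geodesic
ray. With `ν` the position at time `t ≥ 1` of any ray from the Dirac mass through `μ₁`, it gives
distance zero to the dilate of `μ₁` (`IsGeodesicRay.eq_dilate`). The Busemann function is then the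
limit of the square root of a quadratic minus its linear growth. Optimal couplings need not exist
for this, and the triangle inequality for `W2` is not used. -/

namespace WassersteinBusemann

/-! ### Asymptotics of the square root of a quadratic -/

section Limit

/-- If `f t ^ 2 = κ² t² + t b + a` with `f ≥ 0` and `κ > 0`, then `f t - κ t → b / (2 κ)`. -/
theorem tendsto_sub_mul_of_sq_eq {f : ℝ≥0 → ℝ} {κ a b : ℝ} (hκ : 0 < κ)
    (hf : ∀ᶠ t in atTop, 0 ≤ f t ∧ f t ^ 2 = κ ^ 2 * (t : ℝ) ^ 2 + t * b + a) :
    Tendsto (fun t : ℝ≥0 => f t - κ * (t : ℝ)) atTop (𝓝 (b / (2 * κ))) := by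
  -- Multiplying by the conjugate and dividing by `t` gives `f t - κ t = (b + a / t) / (f t / t +
  -- κ)`, whose denominator tends to `2 κ`.
  have hinv : Tendsto (fun t : ℝ≥0 => ((t : ℝ))⁻¹) atTop (𝓝 0) :=
    tendsto_inv_atTop_zero.comp (NNReal.tendsto_coe_atTop.2 tendsto_id)
  have hnum : Tendsto (fun t : ℝ≥0 => b + a * (t : ℝ)⁻¹) atTop (𝓝 b) := by
    simpa using (hinv.const_mul a).const_add b
  have hrad : Tendsto (fun t : ℝ≥0 => κ ^ 2 + (b + a * (t : ℝ)⁻¹) * (t : ℝ)⁻¹) atTop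
      (𝓝 (κ ^ 2)) := by
    simpa using (hnum.mul hinv).const_add (κ ^ 2)
  have hden : Tendsto (fun t : ℝ≥0 =>
      Real.sqrt (κ ^ 2 + (b + a * (t : ℝ)⁻¹) * (t : ℝ)⁻¹) + κ) atTop (𝓝 (2 * κ)) := by
    have h := ((Real.continuous_sqrt.tendsto _).comp hrad).add_const κ
    rwa [Real.sqrt_sq hκ.le, ← two_mul] at h
  refine (hnum.div hden (by positivity)).congr' ?_
  filter_upwards [hf, eventually_gt_atTop 0] with t ⟨h0, h2⟩ ht
  have ht' : (0 : ℝ) < t := ht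
  have hs : Real.sqrt (κ ^ 2 + (b + a * (t : ℝ)⁻¹) * (t : ℝ)⁻¹) = f t / t := by
    rw [← Real.sqrt_sq (div_nonneg h0 ht'.le), div_pow, h2]
    congr 1
    field_simp
    ring
  have hpos : 0 < f t / t + κ := by positivity
  simp only [Pi.div_apply]
  rw [hs, div_eq_iff hpos.ne']
  field_simp
  linear_combination -h2

end Limit

variable {d : ℕ}

instance (μ : P2 d) : IsProbabilityMeasure μ.measure := μ.2.1

theorem P2.ext_measure {μ ν : P2 d} (h : μ.measure = ν.measure) : μ = ν := Subtype.ext h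

@[simp] theorem P2.measure_dirac (x : EuclideanSpace ℝ (Fin d)) :
    (P2.dirac x).measure = Measure.dirac x := rfl

theorem P2.memLp_sub (x₀ : EuclideanSpace ℝ (Fin d)) (μ : P2 d) :
    MemLp (fun x => x - x₀) 2 μ.measure := by
  have h : MemLp (fun x : EuclideanSpace ℝ (Fin d) => x) 2 μ.measure :=
    (memLp_two_iff_integrable_sq_norm aestronglyMeasurable_id).2 μ.2.2
  exact h.sub (memLp_const x₀)

theorem P2.integrable_sq_sub (x₀ : EuclideanSpace ℝ (Fin d)) (μ : P2 d) :
    Integrable (fun x => ‖x - x₀‖ ^ 2) μ.measure :=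
  (memLp_two_iff_integrable_sq_norm (μ.memLp_sub x₀).1).1 (μ.memLp_sub x₀)

/-- The second moment of `μ` about `x₀`. -/
noncomputable def P2.moment (x₀ : EuclideanSpace ℝ (Fin d)) (μ : P2 d) : ℝ :=
  ∫ y, ‖y - x₀‖ ^ 2 ∂μ.measure

theorem P2.moment_dirac (x₀ x : EuclideanSpace ℝ (Fin d)) :
    (P2.dirac x).moment x₀ = ‖x - x₀‖ ^ 2 := by
  simp [P2.moment]

theorem P2.eq_dirac_of_moment_eq_zero {x₀ : EuclideanSpace ℝ (Fin d)} {μ : P2 d}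
    (h : μ.moment x₀ = 0) : μ = P2.dirac x₀ := by
  have hae := (integral_eq_zero_iff_of_nonneg (fun _ => by positivity)
    (μ.integrable_sq_sub x₀)).1 h
  have hae' : (fun x : EuclideanSpace ℝ (Fin d) => x) =ᵐ[μ.measure] fun _ => x₀ := by
    filter_upwards [hae] with x hx
    simpa [sub_eq_zero] using hx
  refine P2.ext_measure ?_
  have h' : μ.measure.map (fun x => x) = μ.measure.map fun _ => x₀ := Measure.map_congr hae'
  rwa [Measure.map_id', Measure.map_const, measure_univ, one_smul] at h'

/-! ### Couplings: moments, cost and correlation -/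

section Couplings

variable {μ ν : P2 d}
  {γ : Measure (EuclideanSpace ℝ (Fin d) × EuclideanSpace ℝ (Fin d))}

theorem measurePreserving_fst_of_mem (hγ : γ ∈ couplings μ ν) :
    MeasurePreserving Prod.fst γ μ.measure := ⟨measurable_fst, hγ.2.1⟩

theorem measurePreserving_snd_of_mem (hγ : γ ∈ couplings μ ν) :
    MeasurePreserving Prod.snd γ ν.measure := ⟨measurable_snd, hγ.2.2⟩

theorem map_swap_mem_couplings (hγ : γ ∈ couplings μ ν) :
    γ.map Prod.swap ∈ couplings ν μ := by
  have := hγ.1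
  refine ⟨Measure.isProbabilityMeasure_map measurable_swap.aemeasurable, ?_, ?_⟩
  · rw [Measure.map_map measurable_fst measurable_swap]; exact hγ.2.2
  · rw [Measure.map_map measurable_snd measurable_swap]; exact hγ.2.1

theorem couplings_nonempty (μ ν : P2 d) : (couplings μ ν).Nonempty :=
  ⟨μ.measure.prod ν.measure, inferInstance, by simp, by simp⟩

theorem integrable_sq_fst (hγ : γ ∈ couplings μ ν) (x₀ : EuclideanSpace ℝ (Fin d)) :
    Integrable (fun p => ‖p.1 - x₀‖ ^ 2) γ :=
  (measurePreserving_fst_of_mem hγ).integrable_comp_of_integrable (μ.integrable_sq_sub x₀)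

theorem integrable_sq_snd (hγ : γ ∈ couplings μ ν) (x₀ : EuclideanSpace ℝ (Fin d)) :
    Integrable (fun p => ‖p.2 - x₀‖ ^ 2) γ :=
  (measurePreserving_snd_of_mem hγ).integrable_comp_of_integrable (ν.integrable_sq_sub x₀)

theorem integral_sq_fst (hγ : γ ∈ couplings μ ν) (x₀ : EuclideanSpace ℝ (Fin d)) :
    ∫ p, ‖p.1 - x₀‖ ^ 2 ∂γ = μ.moment x₀ := by
  rw [P2.moment, ← hγ.2.1, integral_map measurable_fst.aemeasurable]
  rw [hγ.2.1]
  exact (μ.integrable_sq_sub x₀).1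

theorem integral_sq_snd (hγ : γ ∈ couplings μ ν) (x₀ : EuclideanSpace ℝ (Fin d)) :
    ∫ p, ‖p.2 - x₀‖ ^ 2 ∂γ = ν.moment x₀ := by
  rw [P2.moment, ← hγ.2.2, integral_map measurable_snd.aemeasurable]
  rw [hγ.2.2]
  exact (ν.integrable_sq_sub x₀).1

theorem integrable_sq_dist (hγ : γ ∈ couplings μ ν) :
    Integrable (fun p => ‖p.1 - p.2‖ ^ 2) γ := by
  have h1 := (μ.memLp_sub 0).comp_measurePreserving (measurePreserving_fst_of_mem hγ)
  have h2 := (ν.memLp_sub 0).comp_measurePreserving (measurePreserving_snd_of_mem hγ)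
  have h := h1.sub h2
  simpa using (memLp_two_iff_integrable_sq_norm h.1).1 h

theorem inner_sub_sub_eq (x₀ x y : EuclideanSpace ℝ (Fin d)) :
    inner ℝ (x - x₀) (y - x₀) = (‖x - x₀‖ ^ 2 + ‖y - x₀‖ ^ 2 - ‖x - y‖ ^ 2) / 2 := by
  have h := norm_sub_sq_real (x - x₀) (y - x₀)
  rw [sub_sub_sub_cancel_right] at h
  linarith

theorem integrable_inner_sub (hγ : γ ∈ couplings μ ν) (x₀ : EuclideanSpace ℝ (Fin d)) :
    Integrable (fun p => inner ℝ (p.1 - x₀) (p.2 - x₀)) γ := by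
  simp_rw [inner_sub_sub_eq]
  exact (((integrable_sq_fst hγ x₀).add (integrable_sq_snd hγ x₀)).sub
    (integrable_sq_dist hγ)).div_const 2

theorem integral_inner_sub (hγ : γ ∈ couplings μ ν) (x₀ : EuclideanSpace ℝ (Fin d)) :
    ∫ p, inner ℝ (p.1 - x₀) (p.2 - x₀) ∂γ =
      (μ.moment x₀ + ν.moment x₀ - transportCost γ) / 2 := by
  simp_rw [inner_sub_sub_eq]
  have hsum : Integrable (fun p => ‖p.1 - x₀‖ ^ 2 + ‖p.2 - x₀‖ ^ 2) γ :=
    (integrable_sq_fst hγ x₀).add (integrable_sq_snd hγ x₀)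
  rw [integral_div, integral_sub hsum (integrable_sq_dist hγ),
    integral_add (integrable_sq_fst hγ x₀) (integrable_sq_snd hγ x₀),
    integral_sq_fst hγ, integral_sq_snd hγ, transportCost]

theorem transportCost_nonneg
    (γ : Measure (EuclideanSpace ℝ (Fin d) × EuclideanSpace ℝ (Fin d))) :
    0 ≤ transportCost γ :=
  integral_nonneg fun _ => by positivity

end Couplings

/-! ### The Wasserstein distance -/

section Distance

theorem W2_nonneg (μ ν : P2 d) : 0 ≤ W2 μ ν := Real.sqrt_nonneg _

theorem W2_sq_isGLB (μ ν : P2 d) : IsGLB (transportCost '' couplings μ ν) (W2 μ ν ^ 2) := by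
  have h0 : (0 : ℝ) ∈ lowerBounds (transportCost '' couplings μ ν) := by
    rintro _ ⟨γ, -, rfl⟩
    exact transportCost_nonneg γ
  have hne := (couplings_nonempty μ ν).image transportCost
  rw [W2, Real.sq_sqrt (le_csInf hne h0)]
  exact isGLB_csInf hne ⟨0, h0⟩

theorem W2_sq_le {μ ν : P2 d}
    {γ : Measure (EuclideanSpace ℝ (Fin d) × EuclideanSpace ℝ (Fin d))}
    (hγ : γ ∈ couplings μ ν) : W2 μ ν ^ 2 ≤ transportCost γ :=
  (W2_sq_isGLB μ ν).1 ⟨γ, hγ, rfl⟩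

theorem transportCost_map_swap
    (γ : Measure (EuclideanSpace ℝ (Fin d) × EuclideanSpace ℝ (Fin d))) :
    transportCost (γ.map Prod.swap) = transportCost γ := by
  rw [transportCost, integral_map measurable_swap.aemeasurable
    (by fun_prop)]
  simp [transportCost, norm_sub_rev]

theorem W2_sq_le_swap (μ ν : P2 d) : W2 μ ν ^ 2 ≤ W2 ν μ ^ 2 := by
  refine (W2_sq_isGLB ν μ).2 ?_
  rintro _ ⟨γ, hγ, rfl⟩
  rw [← transportCost_map_swap]
  exact W2_sq_le (map_swap_mem_couplings hγ)

theorem W2_comm (μ ν : P2 d) : W2 μ ν = W2 ν μ :=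
  (sq_eq_sq₀ (W2_nonneg _ _) (W2_nonneg _ _)).1
    (le_antisymm (W2_sq_le_swap μ ν) (W2_sq_le_swap ν μ))

theorem W2_self (μ : P2 d) : W2 μ μ = 0 := by
  have hm : Measurable fun x : EuclideanSpace ℝ (Fin d) => (x, x) := by fun_prop
  have hγ : μ.measure.map (fun x => (x, x)) ∈ couplings μ μ := by
    refine ⟨Measure.isProbabilityMeasure_map hm.aemeasurable, ?_, ?_⟩
    · rw [Measure.map_map measurable_fst hm]; exact Measure.map_id
    · rw [Measure.map_map measurable_snd hm]; exact Measure.map_id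
  have h : transportCost (μ.measure.map fun x => (x, x)) = 0 := by
    rw [transportCost, integral_map hm.aemeasurable (by fun_prop)]
    simp
  have := W2_sq_le hγ
  rw [h] at this
  exact pow_eq_zero_iff two_ne_zero |>.1 (le_antisymm this (sq_nonneg _))

/-- The first coordinate is almost surely `x₀` under every coupling, so all couplings have the same
cost. -/
theorem W2_dirac_sq (x₀ : EuclideanSpace ℝ (Fin d)) (ν : P2 d) :
    W2 (P2.dirac x₀) ν ^ 2 = ν.moment x₀ := by
  have key : ∀ γ ∈ couplings (P2.dirac x₀) ν, transportCost γ = ν.moment x₀ := by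
    intro γ hγ
    have hae : ∀ᵐ p ∂γ, p.1 = x₀ := by
      refine ae_of_ae_map (p := fun x => x = x₀) measurable_fst.aemeasurable ?_
      rw [hγ.2.1, P2.measure_dirac, ae_dirac_eq]
      rfl
    rw [← integral_sq_snd hγ, transportCost]
    refine integral_congr_ae ?_
    filter_upwards [hae] with p hp
    rw [hp, norm_sub_rev]
  refine (W2_sq_isGLB _ ν).unique ?_
  have : transportCost '' couplings (P2.dirac x₀) ν = {ν.moment x₀} := by
    obtain ⟨γ, hγ⟩ := couplings_nonempty (P2.dirac x₀) ν
    refine Set.eq_singleton_iff_unique_mem.2 ⟨⟨γ, hγ, key γ hγ⟩, ?_⟩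
    rintro _ ⟨γ, hγ, rfl⟩
    exact key γ hγ
  rw [this]
  exact isGLB_singleton

/-- Measures at Wasserstein distance zero have the same integrals of bounded Lipschitz functions,
hence coincide. -/
theorem eq_of_W2_eq_zero {μ ν : P2 d} (h : W2 μ ν = 0) : μ = ν := by
  have hint : ∀ f : EuclideanSpace ℝ (Fin d) → ℝ, (∃ C : ℝ, ∀ x y, dist (f x) (f y) ≤ C) →
      (∃ L, LipschitzWith L f) → ∫ x, f x ∂μ.measure = ∫ x, f x ∂ν.measure := by
    rintro f ⟨C, hC⟩ ⟨L, hL⟩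
    have hfm : ∀ ρ : Measure (EuclideanSpace ℝ (Fin d)), AEStronglyMeasurable f ρ :=
      fun ρ => hL.continuous.aestronglyMeasurable
    have hfi : ∀ ρ : P2 d, Integrable f ρ.measure := fun ρ => by
      refine Integrable.of_bound (hfm _) (‖f 0‖ + C) (.of_forall fun x => ?_)
      have h1 := norm_add_le (f 0) (f x - f 0)
      have h2 := hC x 0
      rw [dist_eq_norm] at h2
      rw [add_sub_cancel] at h1
      linarith
    have key : ∀ γ ∈ couplings μ ν,
        (∫ x, f x ∂μ.measure - ∫ x, f x ∂ν.measure) ^ 2 ≤ (L : ℝ) ^ 2 * transportCost γ := by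
      intro γ hγ
      have := hγ.1
      have i1 : Integrable (fun p => f p.1) γ :=
        (measurePreserving_fst_of_mem hγ).integrable_comp_of_integrable (hfi μ)
      have i2 : Integrable (fun p => f p.2) γ :=
        (measurePreserving_snd_of_mem hγ).integrable_comp_of_integrable (hfi ν)
      have e1 : ∫ x, f x ∂μ.measure = ∫ p, f p.1 ∂γ := by
        rw [← hγ.2.1, integral_map measurable_fst.aemeasurable (hfm _)]
      have e2 : ∫ x, f x ∂ν.measure = ∫ p, f p.2 ∂γ := by
        rw [← hγ.2.2, integral_map measurable_snd.aemeasurable (hfm _)]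
      rw [e1, e2, ← integral_sub i1 i2]
      have hpt : ∀ p : EuclideanSpace ℝ (Fin d) × EuclideanSpace ℝ (Fin d),
          (f p.1 - f p.2) ^ 2 ≤ (L : ℝ) ^ 2 * ‖p.1 - p.2‖ ^ 2 := fun p => by
        rw [← mul_pow, ← sq_abs, ← Real.dist_eq, ← dist_eq_norm]
        exact pow_le_pow_left₀ dist_nonneg (hL.dist_le_mul _ _) 2
      have hdom : Integrable (fun p => (L : ℝ) ^ 2 * ‖p.1 - p.2‖ ^ 2) γ :=
        (integrable_sq_dist hγ).const_mul _
      have i3 : Integrable (fun p => (f p.1 - f p.2) ^ 2) γ := by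
        refine hdom.mono' ((i1.sub i2).1.pow 2) (.of_forall fun p => ?_)
        rw [Real.norm_of_nonneg (sq_nonneg _)]
        exact hpt p
      -- Jensen's inequality for the square, since `γ` is a probability measure.
      have hjen : (∫ p, (f p.1 - f p.2) ∂γ) ^ 2 ≤ ∫ p, (f p.1 - f p.2) ^ 2 ∂γ :=
        (even_two.convexOn_pow (𝕜 := ℝ)).map_integral_le (continuous_pow 2).continuousOn
          isClosed_univ (.of_forall fun _ => Set.mem_univ _) (i1.sub i2) i3
      rw [transportCost, ← integral_const_mul]
      exact hjen.trans (integral_mono i3 hdom hpt)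
    have hle : (∫ x, f x ∂μ.measure - ∫ x, f x ∂ν.measure) ^ 2 ≤ (L : ℝ) ^ 2 * W2 μ ν ^ 2 := by
      rcases eq_or_ne (L : ℝ) 0 with hL0 | hL0
      · obtain ⟨γ, hγ⟩ := couplings_nonempty μ ν
        simpa [hL0] using key γ hγ
      · have hLpos : 0 < (L : ℝ) ^ 2 := by positivity
        rw [← div_le_iff₀' hLpos]
        refine (W2_sq_isGLB μ ν).2 ?_
        rintro _ ⟨γ, hγ, rfl⟩
        rw [div_le_iff₀' hLpos]
        exact key γ hγ
    rw [h, zero_pow two_ne_zero, mul_zero] at hle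
    exact sub_eq_zero.1 (pow_eq_zero_iff two_ne_zero |>.1 (le_antisymm hle (sq_nonneg _)))
  let μ' : ProbabilityMeasure (EuclideanSpace ℝ (Fin d)) := ⟨μ.measure, inferInstance⟩
  let ν' : ProbabilityMeasure (EuclideanSpace ℝ (Fin d)) := ⟨ν.measure, inferInstance⟩
  -- Bounded Lipschitz functions determine weak convergence, so the constant sequence `μ'` tends to
  -- `ν'`; limits are unique.
  have ht : Tendsto (fun _ : ℕ => μ') atTop (𝓝 ν') := by
    rw [tendsto_iff_forall_lipschitz_integral_tendsto]
    intro f hC hL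
    rw [show ∫ x, f x ∂(μ' : Measure _) = ∫ x, f x ∂(ν' : Measure _) from hint f hC hL]
    exact tendsto_const_nhds
  have h' : μ' = ν' := tendsto_nhds_unique tendsto_const_nhds ht
  exact P2.ext_measure (congrArg ProbabilityMeasure.toMeasure h')

end Distance

/-! ### Dilations and rays from a Dirac mass -/

section Dilation

/-- The homothety of ratio `t` centred at `x₀`, acting on measures by push-forward. -/
noncomputable def P2.dilate (x₀ : EuclideanSpace ℝ (Fin d)) (t : ℝ) (μ : P2 d) : P2 d :=
  ⟨μ.measure.map fun x => (1 - t) • x₀ + t • x,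
    Measure.isProbabilityMeasure_map (by fun_prop), by
      rw [integrable_map_measure (by fun_prop) (by fun_prop)]
      have h : MemLp (fun x => x₀ + t • (x - x₀)) 2 μ.measure :=
        (memLp_const x₀).add ((μ.memLp_sub x₀).const_smul t)
      refine ((memLp_two_iff_integrable_sq_norm h.1).1 h).congr (.of_forall fun x => ?_)
      have : (1 - t) • x₀ + t • x = x₀ + t • (x - x₀) := by module
      simp [this]⟩

variable (x₀ : EuclideanSpace ℝ (Fin d))

theorem P2.measure_dilate (t : ℝ) (μ : P2 d) :
    (μ.dilate x₀ t).measure = μ.measure.map fun x => (1 - t) • x₀ + t • x := rfl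

theorem homothety_sub (t : ℝ) (x : EuclideanSpace ℝ (Fin d)) :
    (1 - t) • x₀ + t • x - x₀ = t • (x - x₀) := by module

theorem P2.moment_dilate (t : ℝ) (μ : P2 d) :
    (μ.dilate x₀ t).moment x₀ = t ^ 2 * μ.moment x₀ := by
  rw [P2.moment, P2.measure_dilate, integral_map (by fun_prop) (by fun_prop), P2.moment,
    ← integral_const_mul]
  simp_rw [homothety_sub, norm_smul, mul_pow, Real.norm_eq_abs, sq_abs]

theorem P2.dilate_one (μ : P2 d) : μ.dilate x₀ 1 = μ := by
  refine P2.ext_measure ?_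
  rw [P2.measure_dilate]
  simp

theorem P2.dilate_zero (μ : P2 d) : μ.dilate x₀ 0 = P2.dirac x₀ := by
  refine P2.ext_measure ?_
  rw [P2.measure_dilate]
  simp [Measure.map_const]

theorem P2.dilate_dilate (s t : ℝ) (μ : P2 d) :
    (μ.dilate x₀ t).dilate x₀ s = μ.dilate x₀ (s * t) := by
  refine P2.ext_measure ?_
  simp only [P2.measure_dilate]
  rw [Measure.map_map (by fun_prop) (by fun_prop)]
  congr 1
  ext1 x
  simp only [Function.comp]
  module

variable {x₀}

/-- Moving the first coordinate of a coupling by the homothety gives a competitor whose correlation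
is scaled by `t`. -/
theorem W2_dilate_sq_le {t : ℝ} (ht : 0 < t) (μ ν : P2 d) :
    W2 (μ.dilate x₀ t) ν ^ 2 ≤ t ^ 2 * μ.moment x₀ + ν.moment x₀
      - t * (μ.moment x₀ + ν.moment x₀ - W2 μ ν ^ 2) := by
  have key : ∀ γ ∈ couplings μ ν,
      W2 (μ.dilate x₀ t) ν ^ 2 ≤ t ^ 2 * μ.moment x₀ + ν.moment x₀
        - t * (μ.moment x₀ + ν.moment x₀ - transportCost γ) := by
    intro γ hγ
    have := hγ.1
    have hm : Measurable fun p : EuclideanSpace ℝ (Fin d) × EuclideanSpace ℝ (Fin d) =>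
        ((1 - t) • x₀ + t • p.1, p.2) := by fun_prop
    have hγ' : γ.map (fun p => ((1 - t) • x₀ + t • p.1, p.2)) ∈
        couplings (μ.dilate x₀ t) ν := by
      refine ⟨Measure.isProbabilityMeasure_map hm.aemeasurable, ?_, ?_⟩
      · rw [P2.measure_dilate, ← hγ.2.1, Measure.map_map measurable_fst hm,
          Measure.map_map (by fun_prop) measurable_fst]
        rfl
      · rw [Measure.map_map measurable_snd hm]
        exact hγ.2.2
    have h1 := integral_inner_sub hγ' x₀
    rw [integral_map hm.aemeasurable (by fun_prop)] at h1
    simp only [homothety_sub, real_inner_smul_left] at h1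
    rw [integral_const_mul, integral_inner_sub hγ x₀, P2.moment_dilate] at h1
    have h2 := W2_sq_le hγ'
    linarith
  -- Isolating the cost lets the bound pass to the infimum without a minimizer.
  have hle : (W2 (μ.dilate x₀ t) ν ^ 2 - t ^ 2 * μ.moment x₀ - ν.moment x₀
      + t * (μ.moment x₀ + ν.moment x₀)) / t ≤ W2 μ ν ^ 2 := by
    refine (W2_sq_isGLB μ ν).2 ?_
    rintro _ ⟨γ, hγ, rfl⟩
    rw [div_le_iff₀' ht]
    linarith [key γ hγ]
  rw [div_le_iff₀' ht] at hle
  linarith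

/-- The squared Wasserstein distance to `ν` along the dilations of `μ` is an explicit quadratic
polynomial of the ratio. -/
theorem W2_dilate_sq {t : ℝ} (ht : 0 ≤ t) (μ ν : P2 d) :
    W2 (μ.dilate x₀ t) ν ^ 2 = t ^ 2 * μ.moment x₀ + ν.moment x₀
      - t * (μ.moment x₀ + ν.moment x₀ - W2 μ ν ^ 2) := by
  rcases ht.eq_or_lt with rfl | ht
  · rw [P2.dilate_zero, W2_dirac_sq]
    ring
  refine le_antisymm (W2_dilate_sq_le ht μ ν) ?_
  -- The reverse inequality is the same bound for the inverse homothety, applied to the dilated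
  -- measure.
  have h := W2_dilate_sq_le (x₀ := x₀) (inv_pos.2 ht) (μ.dilate x₀ t) ν
  rw [P2.dilate_dilate, inv_mul_cancel₀ ht.ne', P2.dilate_one, P2.moment_dilate] at h
  have h' := mul_le_mul_of_nonneg_left h ht.le
  have e : t * (t⁻¹ ^ 2 * (t ^ 2 * μ.moment x₀) + ν.moment x₀
      - t⁻¹ * (t ^ 2 * μ.moment x₀ + ν.moment x₀ - W2 (μ.dilate x₀ t) ν ^ 2)) =
      t * μ.moment x₀ + t * ν.moment x₀
        - (t ^ 2 * μ.moment x₀ + ν.moment x₀ - W2 (μ.dilate x₀ t) ν ^ 2) := by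
    field_simp
  rw [e] at h'
  linarith

theorem W2_dilate_dilate_of_le {s t : ℝ} (hs : 0 ≤ s) (hst : s ≤ t) (μ : P2 d) :
    W2 (μ.dilate x₀ s) (μ.dilate x₀ t) = (t - s) * W2 (P2.dirac x₀) μ := by
  rcases (hs.trans hst).eq_or_lt with ht | ht
  · obtain rfl : s = t := le_antisymm hst (ht ▸ hs)
    simp [W2_self]
  -- The dilate at `s` is the dilate at `t` shrunk by `s / t`, so the quadratic can be evaluated
  -- with both arguments equal to the latter.
  have h := W2_dilate_sq (x₀ := x₀) (div_nonneg hs ht.le) (μ.dilate x₀ t) (μ.dilate x₀ t)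
  rw [P2.dilate_dilate, div_mul_cancel₀ _ ht.ne', W2_self, P2.moment_dilate] at h
  refine (sq_eq_sq₀ (W2_nonneg _ _) (mul_nonneg (sub_nonneg.2 hst) (W2_nonneg _ _))).1 ?_
  rw [h, mul_pow, W2_dirac_sq]
  field_simp
  ring

theorem isGeodesicRay_dilate (μ : P2 d) :
    IsGeodesicRay W2 fun t : ℝ≥0 => μ.dilate x₀ t := by
  intro s t
  simp only [NNReal.coe_zero, NNReal.coe_one, P2.dilate_zero, P2.dilate_one]
  rcases le_total s t with h | h
  · have h' : (s : ℝ) ≤ t := h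
    rw [W2_dilate_dilate_of_le s.coe_nonneg h', abs_of_nonneg (sub_nonneg.2 h')]
  · have h' : (t : ℝ) ≤ s := h
    rw [W2_comm, W2_dilate_dilate_of_le t.coe_nonneg h', abs_sub_comm, abs_of_nonneg (sub_nonneg.2 h')]

/-- After time `1`, a geodesic ray issued from a Dirac mass is determined by its position at
time `1`. -/
theorem IsGeodesicRay.eq_dilate {μ : ℝ≥0 → P2 d} (hμ : IsGeodesicRay W2 μ)
    (h0 : μ 0 = P2.dirac x₀) {t : ℝ≥0} (ht : 1 ≤ t) : μ t = (μ 1).dilate x₀ t := by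
  have ht' : (1 : ℝ) ≤ t := ht
  have h1 : W2 (P2.dirac x₀) (μ t) = t * W2 (P2.dirac x₀) (μ 1) := by
    have := hμ 0 t
    rwa [h0, NNReal.coe_zero, sub_zero, abs_of_nonneg t.coe_nonneg] at this
  have h2 : W2 (μ 1) (μ t) = (t - 1) * W2 (P2.dirac x₀) (μ 1) := by
    have := hμ 1 t
    rwa [h0, NNReal.coe_one, abs_of_nonneg (sub_nonneg.2 ht')] at this
  have hm : (μ t).moment x₀ = (t : ℝ) ^ 2 * (μ 1).moment x₀ := by
    rw [← W2_dirac_sq, ← W2_dirac_sq, h1, mul_pow]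
  refine (eq_of_W2_eq_zero ?_).symm
  -- The ray condition fixes the moment of `μ t` and its distance to `μ 1`; with these values the
  -- quadratic vanishes.
  have h := W2_dilate_sq (x₀ := x₀) t.coe_nonneg (μ 1) (μ t)
  refine pow_eq_zero_iff two_ne_zero |>.1 ?_
  rw [h, h2, hm, mul_pow, W2_dirac_sq]
  ring

end Dilation

/-! ### Busemann limits, Wasserstein and Euclidean -/

section Busemann

variable {x₀ : EuclideanSpace ℝ (Fin d)}

theorem tendsto_busemannApprox_W2 {μ : ℝ≥0 → P2 d} (hμ : IsGeodesicRay W2 μ)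
    (h0 : μ 0 = P2.dirac x₀) (hκ : 0 < speed W2 μ) (ν : P2 d) :
    Tendsto (busemannApprox W2 μ ν) atTop
      (𝓝 ((W2 (μ 1) ν ^ 2 - speed W2 μ ^ 2 - ν.moment x₀) / (2 * speed W2 μ))) := by
  refine tendsto_sub_mul_of_sq_eq (a := ν.moment x₀) hκ ?_
  filter_upwards [eventually_ge_atTop 1] with t ht
  refine ⟨W2_nonneg _ _, ?_⟩
  rw [hμ.eq_dilate h0 ht, W2_dilate_sq t.coe_nonneg, speed, h0, W2_dirac_sq]
  ring

theorem isGeodesicRay_dist {E : Type*} [NormedAddCommGroup E] [NormedSpace ℝ E] {x v : E}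
    {c : ℝ≥0 → E} (hc : ∀ t : ℝ≥0, c t = x + (t : ℝ) • v) : IsGeodesicRay dist c := by
  intro s t
  simp only [hc, dist_add_left, NNReal.coe_zero, NNReal.coe_one, zero_smul, one_smul,
    dist_zero_left]
  rw [dist_eq_norm, ← sub_smul, norm_smul, Real.norm_eq_abs, abs_sub_comm]

theorem tendsto_busemannApprox_dist {E : Type*} [NormedAddCommGroup E] [InnerProductSpace ℝ E]
    {x v : E} (hv : v ≠ 0) {c : ℝ≥0 → E} (hc : ∀ t : ℝ≥0, c t = x + (t : ℝ) • v) (y : E) :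
    Tendsto (busemannApprox dist c y) atTop (𝓝 (-2 * inner ℝ v (y - x) / (2 * ‖v‖))) := by
  have hs : speed dist c = ‖v‖ := by simp [speed, hc]
  have hf : busemannApprox dist c y = fun t : ℝ≥0 => dist (c t) y - ‖v‖ * (t : ℝ) := by
    ext t
    rw [busemannApprox, hs]
  rw [hf]
  refine tendsto_sub_mul_of_sq_eq (a := ‖y - x‖ ^ 2) (norm_pos_iff.2 hv)
    (.of_forall fun t => ⟨dist_nonneg, ?_⟩)
  rw [hc, dist_eq_norm, show x + (t : ℝ) • v - y = (t : ℝ) • v - (y - x) by abel,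
    norm_sub_sq_real, norm_smul, real_inner_smul_left, Real.norm_eq_abs, mul_pow, sq_abs]
  ring

end Busemann

end WassersteinBusemann

/-! ### The main theorem -/

open WassersteinBusemann in
theorem corollary5 (d : ℕ) (x₀ : EuclideanSpace ℝ (Fin d))
    (μ₁ : WassersteinBusemann.P2 d) (hμ₁ : μ₁ ≠ WassersteinBusemann.P2.dirac x₀) :
    -- there is a geodesic ray from the Dirac mass at `x₀` through `μ₁`
    (∃ μ : ℝ≥0 → WassersteinBusemann.P2 d,
      WassersteinBusemann.IsGeodesicRay WassersteinBusemann.W2 μ ∧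
      μ 0 = WassersteinBusemann.P2.dirac x₀ ∧ μ 1 = μ₁ ∧
      ∀ t : ℝ≥0, (μ t).measure =
        μ₁.measure.map (fun x => (1 - (t : ℝ)) • x₀ + (t : ℝ) • x)) ∧
    -- and for every such ray and every `ν`:
    ∀ μ : ℝ≥0 → WassersteinBusemann.P2 d,
      WassersteinBusemann.IsGeodesicRay WassersteinBusemann.W2 μ →
      μ 0 = WassersteinBusemann.P2.dirac x₀ → μ 1 = μ₁ →
      0 < WassersteinBusemann.speed WassersteinBusemann.W2 μ ∧
      ∀ ν : WassersteinBusemann.P2 d,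
        -- the limit defining the Busemann function exists, the integrals converge, and the
        -- Busemann function is the infimum over the couplings of `μ₁` and `ν`
        Tendsto (WassersteinBusemann.busemannApprox WassersteinBusemann.W2 μ ν) atTop
          (𝓝 (WassersteinBusemann.busemann WassersteinBusemann.W2 μ ν)) ∧
        (∀ γ ∈ WassersteinBusemann.couplings μ₁ ν,
          Integrable (fun p => inner ℝ (p.1 - x₀) (p.2 - x₀)) γ) ∧
        IsGLB (WassersteinBusemann.innerCost
            (WassersteinBusemann.speed WassersteinBusemann.W2 μ) x₀ ''
            WassersteinBusemann.couplings μ₁ ν)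
          (WassersteinBusemann.busemann WassersteinBusemann.W2 μ ν) ∧
        -- equivalence with the quadratic optimal transport problem between `μ₁` and `ν`:
        -- objectives, optimal values and minimizers
        (∀ γ ∈ WassersteinBusemann.couplings μ₁ ν,
          WassersteinBusemann.innerCost
              (WassersteinBusemann.speed WassersteinBusemann.W2 μ) x₀ γ =
            (WassersteinBusemann.transportCost γ
              - WassersteinBusemann.speed WassersteinBusemann.W2 μ ^ 2
              - ∫ y, ‖y - x₀‖ ^ 2 ∂ν.measure) /
              (2 * WassersteinBusemann.speed WassersteinBusemann.W2 μ)) ∧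
        WassersteinBusemann.busemann WassersteinBusemann.W2 μ ν =
          (WassersteinBusemann.W2 μ₁ ν ^ 2
            - WassersteinBusemann.speed WassersteinBusemann.W2 μ ^ 2
            - ∫ y, ‖y - x₀‖ ^ 2 ∂ν.measure) /
            (2 * WassersteinBusemann.speed WassersteinBusemann.W2 μ) ∧
        {γ | γ ∈ WassersteinBusemann.couplings μ₁ ν ∧
            IsMinOn (WassersteinBusemann.innerCost
                (WassersteinBusemann.speed WassersteinBusemann.W2 μ) x₀)
              (WassersteinBusemann.couplings μ₁ ν) γ} =
          WassersteinBusemann.optimalCouplings μ₁ ν ∧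
        -- if `μ₁` is a Dirac mass, the Euclidean Busemann function is lifted by integration
        ∀ x₁ : EuclideanSpace ℝ (Fin d), μ₁ = WassersteinBusemann.P2.dirac x₁ →
          ∀ c : ℝ≥0 → EuclideanSpace ℝ (Fin d),
            (∀ t : ℝ≥0, c t = x₀ + (t : ℝ) • (x₁ - x₀)) →
            WassersteinBusemann.IsGeodesicRay dist c ∧
            (∀ y, Tendsto (WassersteinBusemann.busemannApprox dist c y) atTop
              (𝓝 (WassersteinBusemann.busemann dist c y))) ∧
            Integrable (WassersteinBusemann.busemann dist c) ν.measure ∧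
            WassersteinBusemann.busemann WassersteinBusemann.W2 μ ν =
              ∫ y, WassersteinBusemann.busemann dist c y ∂ν.measure := by
  refine ⟨⟨fun t => μ₁.dilate x₀ t, isGeodesicRay_dilate μ₁, ?_, ?_, fun t => rfl⟩, ?_⟩
  · simp [P2.dilate_zero]
  · simp [P2.dilate_one]
  intro μ hμ h0 h1
  have hκ2 : speed W2 μ ^ 2 = μ₁.moment x₀ := by rw [speed, h0, h1, W2_dirac_sq]
  have hκ : 0 < speed W2 μ := by
    refine lt_of_le_of_ne (W2_nonneg _ _) fun h => hμ₁ (P2.eq_dirac_of_moment_eq_zero (x₀ := x₀) ?_)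
    rw [← hκ2, ← h, zero_pow two_ne_zero]
  refine ⟨hκ, fun ν => ?_⟩
  have hlim := tendsto_busemannApprox_W2 hμ h0 hκ ν
  rw [h1] at hlim
  have hB : busemann W2 μ ν =
      (W2 μ₁ ν ^ 2 - speed W2 μ ^ 2 - ν.moment x₀) / (2 * speed W2 μ) := hlim.limUnder_eq
  have hcost : ∀ γ ∈ couplings μ₁ ν, innerCost (speed W2 μ) x₀ γ =
      (transportCost γ - speed W2 μ ^ 2 - ν.moment x₀) / (2 * speed W2 μ) := by
    intro γ hγ
    rw [innerCost, integral_inner_sub hγ, ← hκ2]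
    field_simp
    ring
  have h2κ : 0 < 2 * speed W2 μ := by positivity
  refine ⟨hB ▸ hlim, fun γ hγ => integrable_inner_sub hγ x₀, ⟨?_, ?_⟩, hcost, hB, ?_, ?_⟩
  · rintro _ ⟨γ, hγ, rfl⟩
    rw [hB, hcost γ hγ]
    have := W2_sq_le hγ
    gcongr
  · intro b hb
    rw [hB, le_div_iff₀ h2κ]
    have : b * (2 * speed W2 μ) + speed W2 μ ^ 2 + ν.moment x₀ ≤ W2 μ₁ ν ^ 2 := by
      refine (W2_sq_isGLB μ₁ ν).2 ?_
      rintro _ ⟨γ, hγ, rfl⟩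
      have := hb ⟨γ, hγ, rfl⟩
      rw [hcost γ hγ, le_div_iff₀ h2κ] at this
      linarith
    linarith
  · ext γ
    -- On couplings, `innerCost` is an increasing affine function of `transportCost`, so the
    -- minimizers agree.
    refine and_congr_right fun hγ => forall₂_congr fun γ' hγ' => ?_
    change innerCost _ _ γ ≤ innerCost _ _ γ' ↔ transportCost γ ≤ transportCost γ'
    rw [hcost γ hγ, hcost γ' hγ', div_le_div_iff_of_pos_right h2κ, sub_le_sub_iff_right, sub_le_sub_iff_right]
  · rintro x₁ rfl c hc
    have hv : x₁ - x₀ ≠ 0 := fun h => hμ₁ (by rw [sub_eq_zero.1 h])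
    have hκ' : speed W2 μ = ‖x₁ - x₀‖ := by
      rw [P2.moment_dirac] at hκ2
      exact (sq_eq_sq₀ hκ.le (norm_nonneg _)).1 hκ2
    have hlimE := tendsto_busemannApprox_dist hv hc
    -- Polarization writes the Euclidean Busemann function with squared distances only: it is then
    -- visibly integrable, and integrating `‖y - x₁‖ ^ 2` gives the `W2 ^ 2` term.
    have hBE : busemann dist c = fun y =>
        (‖y - x₁‖ ^ 2 - ‖x₁ - x₀‖ ^ 2 - ‖y - x₀‖ ^ 2) / (2 * ‖x₁ - x₀‖) := by
      ext y
      rw [show busemann dist c y = _ from (hlimE y).limUnder_eq, inner_sub_sub_eq,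
        norm_sub_rev y x₁]
      ring
    have hint : Integrable (fun y => ‖y - x₁‖ ^ 2 - ‖x₁ - x₀‖ ^ 2) ν.measure :=
      (ν.integrable_sq_sub x₁).sub (integrable_const _)
    refine ⟨isGeodesicRay_dist hc, fun y => tendsto_nhds_limUnder ⟨_, hlimE y⟩, ?_, ?_⟩
    · rw [hBE]
      exact (hint.sub (ν.integrable_sq_sub x₀)).div_const _
    · rw [hB, hBE, integral_div, integral_sub hint (ν.integrable_sq_sub x₀),
        integral_sub (ν.integrable_sq_sub x₁) (integrable_const _), W2_dirac_sq, hκ']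
      simp [P2.moment]
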